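/- Let $G=S(\mathbb N)$ be the group of all permutations of $\mathbb N$ with the topology of pointwise convergence; it is a Polish topological group. A compact Hausdorff $G$-space $Y$ (with jointly continuous action) is called strongly uniformly continuous (SUC) if for every $y\in Y$ and every entourage $\varepsilon$ of the unique compatible uniformity of $Y$ there is a neighbourhood $U$ of $e\in G$ such that $(guy,gy)\in\varepsilon$ for all $g\in G$ and $u\in U$. Let $UC(G)$ be the algebra of bounded real functions on $G$ that are both left and right uniformly continuous, and let $SUC(G)$ be the set of bounded continuous real functions on $G$ of the form $F\circ\nu$, where $\nu\colon G\to Y$ is a continuous $G$-map with dense image into a compact SUC $G$-space $Y$ and $F\colon Y\to\mathbb R$ is continuous. Let $G^{UC}$ and $G^{SUC}$ be the Gelfand spaces of these $G$-invariant algebras, with their natural $G$-actions and canonical maps from $G$. Let $G$ act on the one-point compactification $\mathbb N\cup\{\infty\}$ of the discrete space $\mathbb N$, fixing $\infty$, and let $E(G,\mathbb N\cup\{\infty\})$ be the enveloping semigroup of this system, i.e. the pointwise closure of the set of translations in the set of all self-maps of $\mathbb N\cup\{\infty\}$, with the $G$-action $(gp)(x)=g(p(x))$. Then: 1. $G$ is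 SUC-fpp (extremely SUC-amenable): every nonempty compact Hausdorff SUC $G$-space has a fixed point. 2. $G$ is not extremely amenable: some nonempty compact Hausdorff $G$-space has no fixed point. 3. $SUC(G)=UC(G)$, hence $G^{SUC}=G^{UC}$ as $G$-compactifications of $G$; and there is a $G$-equivariant homeomorphism $G^{UC}\cong E(G,\mathbb N\cup\{\infty\})$ compatible with the canonical maps from $G$. 4. Each of the isomorphic $G$-spaces $G^{SUC}$, $G^{UC}$, $E(G,\mathbb N\cup\{\infty\})$ has a unique minimal set (nonempty closed invariant set in which every orbit is dense), and it consists of a single point, which is fixed by $G$. -/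

import Mathlib

open Set Topology Filter
open scoped BoundedContinuousFunction Uniformity

universe u v w

namespace TopDyn

noncomputable section

/-! ## Flows, fixed points, minimal sets -/

/-- `x` is a fixed point of the action of `G`. -/
def IsFixedPoint (G : Type u) {X : Type v} [SMul G X] (x : X) : Prop :=
  ∀ g : G, g • x = x

/-- A minimal subset of a `G`-flow: nonempty, closed, invariant, and every orbit in it is dense
in it. -/
structure IsMinimalSet (G : Type u) {X : Type v} [Group G] [TopologicalSpace X] [MulAction G X]
    (M : Set X) : Prop where
  nonempty : M.Nonempty
  isClosed : IsClosed M
  smul_mem : ∀ (g : G), ∀ x ∈ M, g • x ∈ M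
  dense_orbit : ∀ x ∈ M, M ⊆ closure (MulAction.orbit G x)

/-- The flow `X` has exactly one minimal set, and that minimal set is a fixed point. -/
def UniqueMinimalSetIsFixedPoint (G : Type u) (X : Type v) [Group G] [TopologicalSpace X]
    [MulAction G X] : Prop :=
  ∃ p : X, IsFixedPoint G p ∧ ∀ M : Set X, IsMinimalSet G M ↔ M = {p}

/-- Strong uniform continuity of a uniform `G`-space: for every point `x` and every entourage `ε`
there is a neighbourhood `U` of the identity such that `(g u x, g x) ∈ ε` for all `g ∈ G`,
`u ∈ U`.  (On a compact Hausdorff space the compatible uniformity is unique, so for compact flows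
this is a property of the flow.) -/
def IsSUC (G : Type u) (X : Type v) [Group G] [TopologicalSpace G] [UniformSpace X]
    [MulAction G X] : Prop :=
  ∀ x : X, ∀ ε ∈ 𝓤 X, ∃ U ∈ 𝓝 (1 : G), ∀ g : G, ∀ s ∈ U, ((g * s) • x, g • x) ∈ ε

/-- `G` is extremely amenable: every nonempty compact Hausdorff `G`-space has a fixed point. -/
def IsExtremelyAmenable (G : Type u) [Group G] [TopologicalSpace G] : Prop :=
  ∀ (Y : Type w) [TopologicalSpace Y] [CompactSpace Y] [T2Space Y] [Nonempty Y]
    [MulAction G Y] [ContinuousSMul G Y], ∃ y : Y, IsFixedPoint G y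

/-- `G` is SUC-fpp (extremely SUC-amenable): every nonempty compact Hausdorff `G`-space which is
strongly uniformly continuous has a fixed point. -/
def IsSUCfpp (G : Type u) [Group G] [TopologicalSpace G] : Prop :=
  ∀ (Y : Type w) [UniformSpace Y] [CompactSpace Y] [T2Space Y] [Nonempty Y]
    [MulAction G Y] [ContinuousSMul G Y], IsSUC G Y → ∃ y : Y, IsFixedPoint G y

/-! ## `G`-compactifications -/

/-- `ν : X → Y` is a `G`-compactification of the `G`-space `X`: a continuous `G`-map with dense
image into a compact Hausdorff `G`-space. -/
structure IsGCompactification (G : Type u) {X : Type v} {Y : Type w} [Group G]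
    [TopologicalSpace G] [TopologicalSpace X] [MulAction G X] [TopologicalSpace Y]
    [MulAction G Y] (ν : X → Y) : Prop where
  compact : CompactSpace Y
  t2 : T2Space Y
  continuous_smul : ContinuousSMul G Y
  continuous : Continuous ν
  map_smul : ∀ (g : G) (x : X), ν (g • x) = g • ν x
  denseRange : DenseRange ν

/-- Two maps `ν : X → Y`, `ν' : X → Y'` into `G`-flows are isomorphic: there is a homeomorphism
of `Y` onto `Y'` which is a `G`-map and carries `ν` to `ν'`. -/
def GIso (G : Type u) {X : Type*} {Y : Type*} {Y' : Type*} [TopologicalSpace Y]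
    [TopologicalSpace Y'] [SMul G Y] [SMul G Y'] (ν : X → Y) (ν' : X → Y') : Prop :=
  ∃ Φ : Y ≃ₜ Y', (∀ (g : G) (y : Y), Φ (g • y) = g • Φ y) ∧ ∀ x : X, Φ (ν x) = ν' x

/-! ## The algebras `RUC(X)`, `LUC(G)`, `UC(G)` and `SUC(X)` -/

section Translate

variable {G : Type u} [Group G] {X : Type v} [TopologicalSpace X] [MulAction G X] [ContinuousConstSMul G X]

/-- The right action of `G` on bounded continuous functions: `(f g)(x) = f (g x)`. -/
def translate (g : G) (f : X →ᵇ ℝ) : X →ᵇ ℝ :=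
  f.compContinuous ⟨fun x => g • x, continuous_const_smul g⟩

@[simp] theorem translate_apply (g : G) (f : X →ᵇ ℝ) (x : X) : translate g f x = f (g • x) := rfl

theorem continuous_translate (g : G) : Continuous (translate g : (X →ᵇ ℝ) → (X →ᵇ ℝ)) :=
  BoundedContinuousFunction.continuous_compContinuous _

end Translate

section Algebras

variable {G : Type u} [Group G] [TopologicalSpace G]

variable (G)

/-- `RUC(X)`: the functions `f` whose orbit map `g ↦ f g` is norm continuous. -/
def ruc (X : Type v) [TopologicalSpace X] [MulAction G X] [ContinuousConstSMul G X] :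
    Subalgebra ℝ (X →ᵇ ℝ) where
  carrier := {f | Continuous fun g : G => translate g f}
  mul_mem' {f h} hf hh := by
    have : (fun g : G => translate g (f * h)) = fun g : G => translate g f * translate g h := rfl
    simp only [mem_ofPred_eq] at *
    rw [this]
    exact hf.mul hh
  add_mem' {f h} hf hh := by
    have : (fun g : G => translate g (f + h)) = fun g : G => translate g f + translate g h := rfl
    simp only [mem_ofPred_eq] at *
    rw [this]
    exact hf.add hh
  algebraMap_mem' r := by
    have : (fun g : G => translate g (algebraMap ℝ (X →ᵇ ℝ) r)) =
        fun _ : G => algebraMap ℝ (X →ᵇ ℝ) r := rfl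
    simp only [mem_ofPred_eq]
    rw [this]
    exact continuous_const

variable {G} in
/-- The right translates `(g f)(x) = f (x g)` of a bounded continuous function on `G`. -/
def rtranslate [ContinuousMul G] (g : G) (f : G →ᵇ ℝ) : G →ᵇ ℝ :=
  f.compContinuous ⟨fun x => x * g, continuous_mul_const g⟩

/-- `LUC(G)`: the functions `f` on `G` for which `g ↦ g f` is norm continuous. -/
def luc [ContinuousMul G] : Subalgebra ℝ (G →ᵇ ℝ) where
  carrier := {f | Continuous fun g : G => rtranslate g f}
  mul_mem' {f h} hf hh := by
    have : (fun g : G => rtranslate g (f * h)) =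
      fun g : G => rtranslate g f * rtranslate g h := rfl
    simp only [mem_ofPred_eq] at *
    rw [this]
    exact hf.mul hh
  add_mem' {f h} hf hh := by
    have : (fun g : G => rtranslate g (f + h)) =
      fun g : G => rtranslate g f + rtranslate g h := rfl
    simp only [mem_ofPred_eq] at *
    rw [this]
    exact hf.add hh
  algebraMap_mem' r := by
    have : (fun g : G => rtranslate g (algebraMap ℝ (G →ᵇ ℝ) r)) =
        fun _ : G => algebraMap ℝ (G →ᵇ ℝ) r := rfl
    simp only [mem_ofPred_eq]
    rw [this]
    exact continuous_const

/-- `UC(G) = RUC(G) ∩ LUC(G)`, for the left regular action of `G` on itself. -/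
def uc [ContinuousMul G] : Subalgebra ℝ (G →ᵇ ℝ) := ruc G G ⊓ luc G

section SUC

/-- `f` is a strongly uniformly continuous function on the `G`-space `X`: it comes from a compact
SUC `G`-space `Y`, i.e. `f = F ∘ ν` for a `G`-compactification `ν : X → Y` and a continuous
function `F` on `Y`. -/
def IsSUCFunction {X : Type v} [TopologicalSpace X] [MulAction G X] (f : X →ᵇ ℝ) : Prop :=
  ∃ (Y : Type u) (_ : UniformSpace Y) (_ : MulAction G Y) (ν : X → Y) (F : C(Y, ℝ)),
    IsGCompactification G ν ∧ IsSUC G Y ∧ ∀ x, f x = F (ν x)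

/-- The closed invariant subset `cl (ν X)` of a `G`-space. -/
def closureRange {X : Type v} {Y : Type w} [MulAction G X] [TopologicalSpace Y] [MulAction G Y]
    [ContinuousConstSMul G Y] (ν : X → Y) (hν : ∀ (g : G) (x : X), ν (g • x) = g • ν x) :
    SubMulAction G Y where
  carrier := closure (range ν)
  smul_mem' g y hy := by
    refine map_mem_closure (continuous_const_smul g) hy ?_
    rintro _ ⟨x, rfl⟩
    exact ⟨g • x, hν g x⟩

variable {G} in
/-- The density of the image can be dropped when checking that a function is SUC. -/
theorem IsSUCFunction.of_map {X : Type v} [TopologicalSpace X] [MulAction G X] {f : X →ᵇ ℝ}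
    {Y : Type u} [UniformSpace Y] [CompactSpace Y] [T2Space Y] [MulAction G Y]
    [ContinuousSMul G Y] (hY : IsSUC G Y) (ν : X → Y) (hc : Continuous ν)
    (hν : ∀ (g : G) (x : X), ν (g • x) = g • ν x) (F : C(Y, ℝ)) (hF : ∀ x, f x = F (ν x)) :
    IsSUCFunction G f := by
  let S : SubMulAction G Y := closureRange G ν hν
  have hmem : ∀ x, ν x ∈ S := fun x => subset_closure ⟨x, rfl⟩
  have hS : IsClosed (S : Set Y) := isClosed_closure
  refine ⟨S, inferInstance, inferInstance, fun x => ⟨ν x, hmem x⟩,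
    F.comp ⟨Subtype.val, continuous_subtype_val⟩, ?_, ?_, hF⟩
  · refine ⟨isCompact_iff_compactSpace.mp hS.isCompact, inferInstance, ?_, hc.subtype_mk _, ?_, ?_⟩
    · refine ⟨Continuous.subtype_mk (f := fun p : G × S => p.1 • (p.2 : Y)) ?_ _⟩
      fun_prop
    · intro g x
      exact Subtype.ext (hν g x)
    · intro y
      rw [closure_subtype]
      have : (Subtype.val '' range fun x => (⟨ν x, hmem x⟩ : S)) = range ν := by
        rw [← range_comp]; rfl
      rw [this]
      exact y.2
  · intro x ε hε
    rw [uniformity_subtype, mem_comap] at hε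
    obtain ⟨t, ht, hts⟩ := hε
    obtain ⟨U, hU, h⟩ := hY x t ht
    exact ⟨U, hU, fun g s hs => hts (h g s hs)⟩

theorem IsSUC.prod {Y Z : Type*} [UniformSpace Y] [UniformSpace Z] [MulAction G Y]
    [MulAction G Z] (hY : IsSUC G Y) (hZ : IsSUC G Z) : IsSUC G (Y × Z) := by
  rintro ⟨y, z⟩ ε hε
  rw [uniformity_prod_eq_prod, mem_map, mem_prod_iff] at hε
  obtain ⟨s, hs, t, ht, hst⟩ := hε
  obtain ⟨U, hU, h⟩ := hY y s hs
  obtain ⟨V, hV, h'⟩ := hZ z t ht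
  refine ⟨U ∩ V, inter_mem hU hV, fun g a ha => ?_⟩
  exact hst (show ((_, _), (_, _)) ∈ s ×ˢ t from ⟨h g a ha.1, h' g a ha.2⟩)

variable {G} in
theorem IsSUCFunction.map₂ {X : Type v} [TopologicalSpace X] [MulAction G X] {f h k : X →ᵇ ℝ}
    (hf : IsSUCFunction G f) (hh : IsSUCFunction G h) (op : C(ℝ × ℝ, ℝ))
    (hk : ∀ x, k x = op (f x, h x)) : IsSUCFunction G k := by
  obtain ⟨Y, _, _, ν, F, hν, hY, hF⟩ := hf
  obtain ⟨Z, _, _, η, H, hη, hZ, hH⟩ := hh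
  have := hν.compact
  have := hν.t2
  have := hν.continuous_smul
  have := hη.compact
  have := hη.t2
  have := hη.continuous_smul
  refine IsSUCFunction.of_map (hY.prod G hZ) (fun x => (ν x, η x))
    (hν.continuous.prodMk hη.continuous) ?_
    (op.comp ⟨fun p : Y × Z => (F p.1, H p.2), by fun_prop⟩) ?_
  · intro g x
    rw [hν.map_smul, hη.map_smul]
    rfl
  · intro x
    rw [hk, hF, hH]
    rfl

/-- `SUC(X)`: the algebra of strongly uniformly continuous functions on the `G`-space `X`. -/
def suc (X : Type v) [TopologicalSpace X] [MulAction G X] : Subalgebra ℝ (X →ᵇ ℝ) where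
  carrier := {f | IsSUCFunction G f}
  mul_mem' hf hh := hf.map₂ hh ⟨fun p => p.1 * p.2, by fun_prop⟩ fun _ => rfl
  add_mem' hf hh := hf.map₂ hh ⟨fun p => p.1 + p.2, by fun_prop⟩ fun _ => rfl
  algebraMap_mem' r := by
    let _ : MulAction G PUnit.{u + 1} :=
      { smul := fun _ y => y, one_smul := fun _ => rfl, mul_smul := fun _ _ _ => rfl }
    have : ContinuousSMul G PUnit.{u + 1} := ⟨continuous_snd⟩
    refine IsSUCFunction.of_map (Y := PUnit.{u + 1}) ?_ (fun _ => PUnit.unit) continuous_const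
      (fun _ _ => rfl) (ContinuousMap.const _ r) fun _ => rfl
    intro x ε hε
    exact ⟨univ, Filter.univ_mem, fun g s _ => refl_mem_uniformity hε⟩

end SUC

end Algebras

/-! ## The Gelfand space of a `G`-invariant algebra of functions -/

section Gelfand

variable {G : Type u} [Group G] {X : Type v} [TopologicalSpace X] [MulAction G X]
  [ContinuousConstSMul G X]

variable (G) in
/-- The subalgebra `A` is invariant under the action `f ↦ f g` of `G`. -/
class IsGInvariant (A : Subalgebra ℝ (X →ᵇ ℝ)) : Prop where
  translate_mem : ∀ (g : G), ∀ f ∈ A, translate g f ∈ A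

/-- The Gelfand space `X^A` of an algebra `A` of bounded continuous functions on `X`: the nonzero
multiplicative functionals on `A`, with the weak-star topology. -/
abbrev GelfandSpace (A : Subalgebra ℝ (X →ᵇ ℝ)) : Type v := WeakDual.characterSpace ℝ A

/-- The action `f ↦ f g` on an invariant algebra. -/
def translateCLM (A : Subalgebra ℝ (X →ᵇ ℝ)) [hA : IsGInvariant G A] (g : G) : A →L[ℝ] A where
  toFun f := ⟨translate g f.1, hA.translate_mem g f.1 f.2⟩
  map_add' _ _ := rfl
  map_smul' _ _ := rfl
  cont := ((continuous_translate g).comp continuous_subtype_val).subtype_mk _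

/-- The `G`-action on the Gelfand space: `(g φ)(f) = φ (f g)`. -/
instance gelfandAction (A : Subalgebra ℝ (X →ᵇ ℝ)) [hA : IsGInvariant G A] :
    MulAction G (GelfandSpace A) where
  smul g φ := ⟨StrongDual.toWeakDual
      ((WeakDual.CharacterSpace.toCLM φ).comp (translateCLM A g)), by
    rw [WeakDual.CharacterSpace.eq_set_map_one_map_mul]
    exact ⟨map_one φ, fun f h => map_mul φ (translateCLM A g f) (translateCLM A g h)⟩⟩
  one_smul φ := by
    refine WeakDual.CharacterSpace.ext fun f => ?_
    change φ (translateCLM A 1 f) = φ f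
    congr 1
    ext x
    exact congrArg f.1 (one_smul G x)
  mul_smul g h φ := by
    refine WeakDual.CharacterSpace.ext fun f => ?_
    change φ (translateCLM A (g * h) f) = φ (translateCLM A h (translateCLM A g f))
    congr 1
    ext x
    exact congrArg f.1 (mul_smul g h x)

theorem gelfand_smul_apply (A : Subalgebra ℝ (X →ᵇ ℝ)) [IsGInvariant G A] (g : G)
    (φ : GelfandSpace A) (f : A) : (g • φ) f = φ (translateCLM A g f) := rfl

/-- The canonical map `X → X^A`, sending `x` to the evaluation at `x`. -/
def gelfandMap (A : Subalgebra ℝ (X →ᵇ ℝ)) (x : X) : GelfandSpace A :=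
  ⟨StrongDual.toWeakDual
      ((BoundedContinuousFunction.evalCLM ℝ x).comp A.toSubmodule.subtypeL), by
    rw [WeakDual.CharacterSpace.eq_set_map_one_map_mul]
    exact ⟨rfl, fun f h => rfl⟩⟩

theorem gelfandMap_apply (A : Subalgebra ℝ (X →ᵇ ℝ)) (x : X) (f : A) :
    gelfandMap A x f = f.1 x := rfl

end Gelfand

section Invariance

variable (G : Type u) [Group G] [TopologicalSpace G]

instance isGInvariant_uc [ContinuousMul G] : IsGInvariant G (uc G) where
  translate_mem g f hf := by
    refine ⟨?_, ?_⟩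
    · have h1 : Continuous fun h : G => translate h f := hf.1
      have h2 : (fun h : G => translate h (translate g f)) = fun h : G => translate (g * h) f := by
        funext h
        ext x
        exact congrArg f (smul_smul g h x)
      change Continuous fun h : G => translate h (translate g f)
      rw [h2]
      exact h1.comp (continuous_const_mul g)
    · have h1 : Continuous fun h : G => rtranslate h f := hf.2
      have h2 : (fun h : G => rtranslate h (translate g f)) =
          fun h : G => translate g (rtranslate h f) := by
        funext h
        ext x
        exact congrArg f (mul_assoc g x h).symm
      change Continuous fun h : G => rtranslate h (translate g f)
      rw [h2]
      exact (continuous_translate g).comp h1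

instance isGInvariant_suc (X : Type v) [TopologicalSpace X] [MulAction G X]
    [ContinuousConstSMul G X] : IsGInvariant G (suc G X) where
  translate_mem g f hf := by
    obtain ⟨Y, _, _, ν, F, hν, hY, hF⟩ := hf
    have := hν.continuous_smul
    refine ⟨Y, _, _, ν, F.comp ⟨fun y => g • y, continuous_const_smul g⟩, hν, hY, fun x => ?_⟩
    rw [translate_apply, hF, hν.map_smul]
    rfl

end Invariance

/-! ## The enveloping semigroup -/

section Enveloping

variable (G : Type u) (X : Type v) [Group G] [TopologicalSpace X] [MulAction G X]
  [ContinuousConstSMul G X]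

/-- The enveloping semigroup `E(G, X)`: the closure, in `X → X` with the topology of pointwise
convergence, of the set of translations `x ↦ g x`.  `G` acts on it by `(g p)(x) = g (p x)`. -/
def envelopingSemigroup : SubMulAction G (X → X) where
  carrier := closure (range fun (g : G) (x : X) => g • x)
  smul_mem' g p hp := by
    refine map_mem_closure (continuous_const_smul g) hp ?_
    rintro _ ⟨h, rfl⟩
    exact ⟨g * h, funext fun x => mul_smul g h x⟩

/-- The composition of two elements of `E(G, X)` is again in `E(G, X)`. -/
theorem comp_mem_envelopingSemigroup {p q : X → X} (hp : p ∈ envelopingSemigroup G X)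
    (hq : q ∈ envelopingSemigroup G X) : p ∘ q ∈ envelopingSemigroup G X := by
  have h : ∀ r ∈ range fun (g : G) (x : X) => g • x, r ∘ q ∈ envelopingSemigroup G X := by
    rintro _ ⟨g, rfl⟩
    exact (envelopingSemigroup G X).smul_mem g hq
  have hc : Continuous fun r : X → X => r ∘ q :=
    continuous_pi fun x => continuous_apply (q x)
  have := map_mem_closure hc hp h
  exact closure_closure.subset this

/-- The canonical map `G → E(G, X)`. -/
def toEnveloping (g : G) : envelopingSemigroup G X :=
  ⟨fun x => g • x, subset_closure ⟨g, rfl⟩⟩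

end Enveloping

end

/-! ## The group `S(ℕ)` and its action on `ℕ ∪ {∞}` -/

section Perm

/-- The topology of pointwise convergence on the group of all permutations of `ℕ`. -/
instance permTopology : TopologicalSpace (Equiv.Perm ℕ) :=
  TopologicalSpace.induced (fun g : Equiv.Perm ℕ => (g : ℕ → ℕ)) inferInstance

theorem continuous_perm_apply (n : ℕ) : Continuous fun g : Equiv.Perm ℕ => g n :=
  (continuous_apply n).comp continuous_induced_dom

theorem continuous_perm_iff {Z : Type*} [TopologicalSpace Z] {f : Z → Equiv.Perm ℕ} :
    Continuous f ↔ ∀ n, Continuous fun z => f z n := by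
  rw [continuous_induced_rng, continuous_pi_iff]
  rfl

theorem eventually_eq_of_continuous_nat {Z : Type*} [TopologicalSpace Z] {f : Z → ℕ}
    (hf : Continuous f) (z : Z) : ∀ᶠ y in 𝓝 z, f y = f z :=
  ((isOpen_discrete {f z}).preimage hf).mem_nhds rfl

theorem eventually_perm_apply_eq (g : Equiv.Perm ℕ) (n : ℕ) : ∀ᶠ h in 𝓝 g, h n = g n :=
  eventually_eq_of_continuous_nat (continuous_perm_apply n) g

instance : IsTopologicalGroup (Equiv.Perm ℕ) where
  continuous_mul := by
    refine continuous_perm_iff.mpr fun n => continuous_iff_continuousAt.mpr ?_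
    rintro ⟨g, h⟩
    have h1 : ∀ᶠ p : Equiv.Perm ℕ × Equiv.Perm ℕ in 𝓝 (g, h), p.1 (h n) = g (h n) :=
      eventually_eq_of_continuous_nat ((continuous_perm_apply (h n)).comp continuous_fst) _
    have h2 : ∀ᶠ p : Equiv.Perm ℕ × Equiv.Perm ℕ in 𝓝 (g, h), p.2 n = h n :=
      eventually_eq_of_continuous_nat ((continuous_perm_apply n).comp continuous_snd) _
    refine tendsto_nhds_of_eventually_eq ?_
    filter_upwards [h1, h2] with p hp1 hp2
    simp [hp1, hp2]
  continuous_inv := by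
    refine continuous_perm_iff.mpr fun n => continuous_iff_continuousAt.mpr fun g => ?_
    refine tendsto_nhds_of_eventually_eq ?_
    filter_upwards [eventually_perm_apply_eq g (g⁻¹ n)] with h hh
    rw [Equiv.Perm.inv_eq_iff_eq, hh]
    simp

/-- The natural action of `S(ℕ)` on the one-point compactification `ℕ ∪ {∞}` of the discrete space
`ℕ`, fixing the point at infinity. -/
instance permActionOnePoint : MulAction (Equiv.Perm ℕ) (OnePoint ℕ) where
  smul g x := OnePoint.map g x
  one_smul x := by
    change OnePoint.map (id : ℕ → ℕ) x = x
    rw [OnePoint.map_id]; rfl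
  mul_smul g h x := by
    change OnePoint.map (g ∘ h) x = OnePoint.map g (OnePoint.map h x)
    rw [OnePoint.map_comp]; rfl

@[simp] theorem perm_smul_coe (g : Equiv.Perm ℕ) (n : ℕ) :
    g • (n : OnePoint ℕ) = ((g n : ℕ) : OnePoint ℕ) := rfl

@[simp] theorem perm_smul_infty (g : Equiv.Perm ℕ) :
    g • (OnePoint.infty : OnePoint ℕ) = OnePoint.infty := rfl

instance : ContinuousSMul (Equiv.Perm ℕ) (OnePoint ℕ) where
  continuous_smul := by
    refine continuous_iff_continuousAt.mpr ?_
    rintro ⟨g, x⟩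
    induction x using OnePoint.rec with
    | coe n =>
      have h1 : ∀ᶠ p : Equiv.Perm ℕ × OnePoint ℕ in 𝓝 (g, (n : OnePoint ℕ)), p.1 n = g n :=
        eventually_eq_of_continuous_nat ((continuous_perm_apply n).comp continuous_fst) _
      have h2 : ∀ᶠ p : Equiv.Perm ℕ × OnePoint ℕ in 𝓝 (g, (n : OnePoint ℕ)), p.2 = n := by
        have h3 : ∀ᶠ y : OnePoint ℕ in 𝓝 (n : OnePoint ℕ), y = n := by
          rw [OnePoint.nhds_coe_eq, nhds_discrete]
          simp
        exact (continuous_snd.tendsto (g, (n : OnePoint ℕ))).eventually h3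
      refine tendsto_nhds_of_eventually_eq ?_
      filter_upwards [h1, h2] with p hp1 hp2
      rw [hp2, perm_smul_coe, hp1]
      rfl
    | infty =>
      intro s hs
      rw [mem_map]
      change s ∈ 𝓝 (OnePoint.infty : OnePoint ℕ) at hs
      have hfin : {m : ℕ | (m : OnePoint ℕ) ∉ s}.Finite := by
        have := (OnePoint.tendsto_coe_infty (X := ℕ)).eventually hs
        rw [coclosedCompact_eq_cocompact, cocompact_eq_cofinite, eventually_cofinite] at this
        exact this
      have key : ∀ m ∈ {m : ℕ | (m : OnePoint ℕ) ∉ s},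
          ∀ᶠ p : Equiv.Perm ℕ × OnePoint ℕ in 𝓝 (g, OnePoint.infty),
            p.1 • p.2 ≠ (m : OnePoint ℕ) := by
        intro m _
        have h1 : ∀ᶠ p : Equiv.Perm ℕ × OnePoint ℕ in 𝓝 (g, OnePoint.infty),
            p.1 (g⁻¹ m) = g (g⁻¹ m) :=
          eventually_eq_of_continuous_nat ((continuous_perm_apply (g⁻¹ m)).comp continuous_fst) _
        have h2 : ∀ᶠ p : Equiv.Perm ℕ × OnePoint ℕ in 𝓝 (g, OnePoint.infty),
            p.2 ≠ ((g⁻¹ m : ℕ) : OnePoint ℕ) :=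
          continuousAt_snd.eventually_ne (OnePoint.infty_ne_coe _)
        filter_upwards [h1, h2] with p hp1 hp2 h
        refine hp2 (MulAction.injective p.1 ?_)
        change p.1 • p.2 = p.1 • ((g⁻¹ m : ℕ) : OnePoint ℕ)
        rw [h, perm_smul_coe, hp1]
        simp
      filter_upwards [(eventually_all_finite hfin).mpr key] with p hp
      change p.1 • p.2 ∈ s
      generalize p.1 • p.2 = y at hp
      induction y using OnePoint.rec with
      | infty => exact mem_of_mem_nhds hs
      | coe m =>
        by_contra hm
        exact hp m hm rfl

end Perm

end TopDyn

namespace TopDyn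

noncomputable section

/-! ## The topological group `S(ℕ)` -/

/-! The key fact is combinatorial. For a finite `S ⊆ ℕ` with pointwise stabilizer `H`, the double
coset `H g H` depends only on the finite pattern `{(i, j) ∈ S × S : g i = j}`
(`exists_mul_mul_eq_of_pattern`). An element of `E(G, ℕ ∪ {∞})` near a given one has the same
pattern on `S × S`. So a map on `G` that is uniformly continuous on both sides nearly takes a single
value along permutations close to a point of `E`, and therefore extends continuously to `E`
(`IsBiUniform.exists_extension`).

This extension is applied twice. Orbit maps of a compact SUC flow `Y` are bi-uniform, so they extend
to equivariant maps `E → Y`; the constant map `∞` is a fixed point of `E`, and its image is a fixed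
point of `Y`. Functions in `UC(G)` also extend to `E`, and `E` is itself SUC, since it is a subflow
of a power of `ℕ ∪ {∞}`. Hence `UC(G) ⊆ SUC(G)`; the reverse inclusion holds for every topological
group. So `UC(G)` is exactly `C(E)` restricted to `G`, and Gelfand duality identifies `G^UC` with
`E`.

The constant `∞` lies in every orbit closure of `E`, which forces the unique minimal set. Extreme
amenability fails on the compact space of tournaments, where a transposition reverses an edge. -/

instance polishSpace_perm : PolishSpace (Equiv.Perm ℕ) := by
  -- The permutations are not closed in `ℕ → ℕ`. Recording the inverse as well makes the image
  -- closed, being cut out by the equations for mutually inverse maps.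
  let Φ : Equiv.Perm ℕ → (ℕ → ℕ) × (ℕ → ℕ) := fun g => (g, (g⁻¹ : Equiv.Perm ℕ))
  have hc : Continuous fun g : Equiv.Perm ℕ => (g : ℕ → ℕ) := continuous_induced_dom
  have hΦ : Continuous Φ := hc.prodMk (hc.comp continuous_inv)
  have hind : IsInducing Φ := .of_comp hΦ continuous_fst ⟨rfl⟩
  have hinj : Function.Injective Φ := fun g h hgh =>
    Equiv.coe_fn_injective (congrArg Prod.fst hgh)
  refine IsClosedEmbedding.polishSpace (f := Φ) ⟨⟨hind, hinj⟩, ?_⟩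
  have hrange : range Φ =
      ⋂ n : ℕ, {p : (ℕ → ℕ) × (ℕ → ℕ) | p.2 (p.1 n) = n} ∩ {p | p.1 (p.2 n) = n} := by
    ext p
    simp only [mem_iInter, mem_inter_iff, mem_ofPred_eq]
    constructor
    · rintro ⟨g, rfl⟩ n
      simp [Φ]
    · intro h
      exact ⟨⟨p.1, p.2, fun n => (h n).1, fun n => (h n).2⟩, rfl⟩
  have heval : Continuous fun q : (ℕ → ℕ) × ℕ => q.1 q.2 := by
    refine continuous_iff_continuousAt.mpr fun ⟨a, m⟩ => ?_
    have h1 : ∀ᶠ q : (ℕ → ℕ) × ℕ in 𝓝 (a, m), q.1 m = a m :=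
      eventually_eq_of_continuous_nat ((continuous_apply m).comp continuous_fst) _
    have h2 : ∀ᶠ q : (ℕ → ℕ) × ℕ in 𝓝 (a, m), q.2 = m :=
      eventually_eq_of_continuous_nat continuous_snd _
    refine tendsto_nhds_of_eventually_eq ?_
    filter_upwards [h1, h2] with q hq1 hq2
    simp [hq1, hq2]
  rw [hrange]
  refine isClosed_iInter fun n => IsClosed.inter ?_ ?_
  · exact isClosed_eq (heval.comp (continuous_snd.prodMk ((continuous_apply n).comp continuous_fst)))
      continuous_const
  · exact isClosed_eq (heval.comp (continuous_fst.prodMk ((continuous_apply n).comp continuous_snd)))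
      continuous_const

/-- Every neighbourhood of the identity contains the pointwise stabilizer of a finite set. -/
theorem exists_finset_fixing_subset {U : Set (Equiv.Perm ℕ)} (hU : U ∈ 𝓝 1) :
    ∃ S : Finset ℕ, ∀ g : Equiv.Perm ℕ, (∀ i ∈ S, g i = i) → g ∈ U := by
  rw [nhds_induced, mem_comap] at hU
  obtain ⟨t, ht, htU⟩ := hU
  rw [nhds_pi, Filter.mem_pi'] at ht
  obtain ⟨S, s, hs, hst⟩ := ht
  refine ⟨S, fun g hg => htU (hst fun i hi => ?_)⟩
  change g i ∈ s i
  rw [hg i hi]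
  exact mem_of_mem_nhds (hs i)

/-- A permutation carrying one finite family of distinct points to another. -/
theorem exists_perm_eqOn {S : Finset ℕ} {f : ℕ → ℕ} (hf : InjOn f S) :
    ∃ g : Equiv.Perm ℕ, ∀ i ∈ S, g i = f i := by
  have := Equiv.Perm.isMultiplyPretransitive ℕ S.card
  let e := S.equivFin
  let x : Fin S.card ↪ ℕ := ⟨fun k => e.symm k, Subtype.val_injective.comp e.symm.injective⟩
  let y : Fin S.card ↪ ℕ := ⟨fun k => f (e.symm k), fun a b hab =>
    e.symm.injective (Subtype.ext (hf (e.symm a).2 (e.symm b).2 hab))⟩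
  obtain ⟨g, hg⟩ := MulAction.exists_smul_eq (Equiv.Perm ℕ) x y
  refine ⟨g, fun i hi => ?_⟩
  have h : g (x (e ⟨i, hi⟩)) = y (e ⟨i, hi⟩) := DFunLike.congr_fun hg (e ⟨i, hi⟩)
  change g (e.symm (e ⟨i, hi⟩) : ℕ) = f (e.symm (e ⟨i, hi⟩) : ℕ) at h
  rwa [Equiv.symm_apply_apply] at h

/-- Permutations with the same pattern on `S × S` are in the same double coset of the pointwise
stabilizer of `S`. -/
theorem exists_mul_mul_eq_of_pattern {S : Finset ℕ} {g h : Equiv.Perm ℕ}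
    (hgh : ∀ i ∈ S, ∀ j ∈ S, g i = j ↔ h i = j) :
    ∃ u v : Equiv.Perm ℕ, (∀ i ∈ S, u i = i) ∧ (∀ i ∈ S, v i = i) ∧ h = u * (g * v) := by
  classical
  -- With `u = h v⁻¹ g⁻¹`, the requirements are that `v` be the identity on `S` and equal `g⁻¹ h` on
  -- `h⁻¹ S`. Equality of patterns makes these prescriptions agree on the overlap and be jointly
  -- injective.
  let f : ℕ → ℕ := fun k => if k ∈ S then k else g⁻¹ (h k)
  have hf : ∀ j ∈ S, f (h⁻¹ j) = g⁻¹ j := by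
    intro j hj
    by_cases hi : h⁻¹ j ∈ S
    · have : g (h⁻¹ j) = j := (hgh _ hi j hj).mpr (by simp)
      simp only [f, if_pos hi]
      rw [Equiv.Perm.eq_inv_iff_eq, this]
    · simp only [f, if_neg hi]
      rw [← Equiv.Perm.mul_apply h, mul_inv_cancel, Equiv.Perm.one_apply]
  have hfS : ∀ i ∈ S, f i = i := fun i hi => if_pos hi
  have hcross : ∀ i ∈ S, ∀ j ∈ S, f i = f (h⁻¹ j) → i = h⁻¹ j := by
    intro i hi j hj hij
    rw [hf j hj, hfS i hi, Equiv.Perm.eq_inv_iff_eq] at hij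
    rw [Equiv.Perm.eq_inv_iff_eq]
    exact (hgh i hi j hj).mp hij
  have hinj : InjOn f ↑(S ∪ S.image ⇑h⁻¹) := by
    intro a ha b hb hab
    simp only [Finset.coe_union, Finset.coe_image, mem_union, Finset.mem_coe, mem_image] at ha hb
    rcases ha with ha | ⟨j, hj, rfl⟩ <;> rcases hb with hb | ⟨k, hk, rfl⟩
    · rwa [hfS a ha, hfS b hb] at hab
    · exact hcross a ha k hk hab
    · exact (hcross b hb j hj hab.symm).symm
    · rw [hf j hj, hf k hk] at hab
      rw [g⁻¹.injective hab]
  obtain ⟨v, hv⟩ := exists_perm_eqOn hinj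
  refine ⟨h * v⁻¹ * g⁻¹, v, fun j hj => ?_, fun i hi => ?_, by group⟩
  · have h1 : v (h⁻¹ j) = g⁻¹ j := by
      rw [hv _ (Finset.mem_union_right _ (Finset.mem_image_of_mem _ hj)), hf j hj]
    rw [Equiv.Perm.mul_apply, Equiv.Perm.mul_apply, ← h1]
    simp
  · rw [hv i (Finset.mem_union_left _ hi), hfS i hi]

/-! ## Norm continuity of orbit maps -/

/-- On a compact flow, small group elements move all points uniformly little. -/
theorem eventually_forall_smul_mem {G : Type u} {Y : Type v} [Group G] [TopologicalSpace G]
    [UniformSpace Y] [CompactSpace Y] [MulAction G Y] [ContinuousSMul G Y] {V : Set (Y × Y)}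
    (hV : V ∈ 𝓤 Y) : ∀ᶠ u in 𝓝 (1 : G), ∀ y : Y, (u • y, y) ∈ V := by
  -- Currying gives a continuous map `G → C(Y, Y)`; since `Y` is compact, its continuity at `1` is
  -- uniform convergence.
  let a : C(G × Y, Y) := ⟨fun p => p.1 • p.2, continuous_smul⟩
  have h := ContinuousMap.tendsto_iff_tendstoUniformly.mp (a.curry.continuous.tendsto (1 : G))
  filter_upwards [h _ (symm_le_uniformity hV)] with u hu y
  simpa [a] using hu y

/-- Compactness of the flow alone gives the `RUC` half. The `LUC` half is SUC at the single point `ν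
1`, because `f x = F (x • ν 1)`. -/
theorem IsSUCFunction.mem_uc {G : Type u} [Group G] [TopologicalSpace G] [IsTopologicalGroup G]
    {f : G →ᵇ ℝ} (hf : IsSUCFunction G f) : f ∈ uc G := by
  obtain ⟨Y, _, _, ν, F, hν, hY, hF⟩ := hf
  have := hν.compact
  have := hν.continuous_smul
  constructor
  · change Continuous fun g : G => translate g f
    refine continuous_iff_continuousAt.mpr fun g => Metric.tendsto_nhds.mpr fun ε hε => ?_
    have hFu := CompactSpace.uniformContinuous_of_continuous F.continuous
    have hV := hFu (Metric.dist_mem_uniformity (half_pos hε))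
    have h1 := eventually_forall_smul_mem (G := G) hV
    have h2 : Tendsto (fun h : G => h * g⁻¹) (𝓝 g) (𝓝 1) := by
      simpa using (continuous_mul_const g⁻¹).tendsto g
    filter_upwards [h2.eventually h1] with h hh
    refine lt_of_le_of_lt ((BoundedContinuousFunction.dist_le (half_pos hε).le).mpr fun x => ?_)
      (half_lt_self hε)
    have h3 : dist (F ((h * g⁻¹) • ν (g * x))) (F (ν (g * x))) < ε / 2 := hh (ν (g * x))
    rw [← hν.map_smul, ← hF, ← hF] at h3
    simpa [mul_assoc] using h3.le
  · change Continuous fun g : G => rtranslate g f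
    refine continuous_iff_continuousAt.mpr fun g => Metric.tendsto_nhds.mpr fun ε hε => ?_
    have hFu := CompactSpace.uniformContinuous_of_continuous F.continuous
    obtain ⟨U, hU, h1⟩ := hY (ν 1) _ (hFu (Metric.dist_mem_uniformity (half_pos hε)))
    have h2 : Tendsto (fun h : G => g⁻¹ * h) (𝓝 g) (𝓝 1) := by
      simpa using (continuous_const_mul g⁻¹).tendsto g
    filter_upwards [h2 hU] with h hh
    refine lt_of_le_of_lt ((BoundedContinuousFunction.dist_le (half_pos hε).le).mpr fun x => ?_)
      (half_lt_self hε)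
    have h3 : dist (F ((x * g * (g⁻¹ * h)) • ν 1)) (F ((x * g) • ν 1)) < ε / 2 :=
      h1 (x * g) _ hh
    rw [← hν.map_smul, ← hν.map_smul, ← hF, ← hF] at h3
    have h4 : x * g * (g⁻¹ * h) = x * h := by group
    rw [h4] at h3
    simpa [rtranslate] using h3.le

/-- A map on a topological group is bi-uniformly continuous if it is uniformly continuous for both
the left and the right uniformity. -/
def IsBiUniform {G : Type u} {Z : Type v} [Group G] [TopologicalSpace G] [UniformSpace Z]
    (f : G → Z) : Prop :=
  ∀ V ∈ 𝓤 Z, ∀ᶠ u in 𝓝 (1 : G), ∀ g, (f (u * g), f g) ∈ V ∧ (f (g * u), f g) ∈ V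

theorem isBiUniform_of_mem_uc {G : Type u} [Group G] [TopologicalSpace G] [ContinuousMul G]
    {f : G →ᵇ ℝ} (hf : f ∈ uc G) : IsBiUniform f := by
  intro V hV
  obtain ⟨ε, hε, hεV⟩ := Metric.mem_uniformity_dist.mp hV
  have h1 : Continuous fun g : G => translate g f := hf.1
  have h2 : Continuous fun g : G => rtranslate g f := hf.2
  filter_upwards [Metric.tendsto_nhds.mp (h1.tendsto 1) ε hε,
    Metric.tendsto_nhds.mp (h2.tendsto 1) ε hε] with u hu hu' g
  constructor
  · have := (BoundedContinuousFunction.dist_coe_le_dist g).trans_lt hu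
    exact hεV (by simpa using this)
  · have := (BoundedContinuousFunction.dist_coe_le_dist g).trans_lt hu'
    exact hεV (by simpa [rtranslate] using this)

/-- Compactness controls multiplication on the left, and SUC at `y` is precisely control of
multiplication on the right. -/
theorem IsSUC.isBiUniform_orbit {G : Type u} {Y : Type v} [Group G] [TopologicalSpace G]
    [UniformSpace Y] [CompactSpace Y] [MulAction G Y] [ContinuousSMul G Y] (hY : IsSUC G Y)
    (y : Y) : IsBiUniform fun g : G => g • y := by
  intro V hV
  obtain ⟨U, hU, h⟩ := hY y V hV
  filter_upwards [hU, eventually_forall_smul_mem (G := G) hV] with u hu hu' g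
  exact ⟨by simpa [mul_smul] using hu' (g • y), h g u hu⟩

/-- A basic entourage of the product constrains finitely many coordinates, so a finite intersection
of neighbourhoods suffices. -/
theorem IsSUC.pi {G : Type u} {X : Type v} {ι : Type w} [Group G] [TopologicalSpace G]
    [UniformSpace X] [MulAction G X] (hX : IsSUC G X) : IsSUC G (ι → X) := by
  intro p ε hε
  rw [Pi.uniformity, Filter.mem_iInf] at hε
  obtain ⟨I, hI, V, hV, rfl⟩ := hε
  choose t ht htV using fun i => mem_comap.mp (hV i)
  choose U hU h using fun i : I => hX (p i) (t i) (ht i)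
  have := hI.to_subtype
  refine ⟨⋂ i, U i, iInter_mem.mpr hU, fun g s hs => mem_iInter.mpr fun i => htV i ?_⟩
  exact h i g s (mem_iInter.mp hs i)

theorem IsSUC.subMulAction {G : Type u} {X : Type v} [Group G] [TopologicalSpace G]
    [UniformSpace X] [MulAction G X] (hX : IsSUC G X) (S : SubMulAction G X) : IsSUC G S := by
  intro x ε hε
  rw [uniformity_subtype, mem_comap] at hε
  obtain ⟨t, ht, hts⟩ := hε
  obtain ⟨U, hU, h⟩ := hX x t ht
  exact ⟨U, hU, fun g s hs => hts (h g s hs)⟩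

/-! ## Unique minimal sets -/

/-- A minimal set contains the orbit closures of its points, hence `p`; density of the orbit `{p}`,
which is closed, then leaves nothing else. -/
theorem uniqueMinimalSetIsFixedPoint_of_mem_closure_orbit {G : Type u} {X : Type v} [Group G]
    [TopologicalSpace X] [T1Space X] [MulAction G X] {p : X} (hp : IsFixedPoint G p)
    (h : ∀ x : X, p ∈ closure (MulAction.orbit G x)) : UniqueMinimalSetIsFixedPoint G X := by
  have horb : MulAction.orbit G p = {p} := by
    ext x
    constructor
    · rintro ⟨g, rfl⟩
      exact hp g
    · rintro rfl
      exact MulAction.mem_orbit_self _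
  refine ⟨p, hp, fun M => ⟨fun hM => ?_, ?_⟩⟩
  · obtain ⟨x, hx⟩ := hM.nonempty
    have hpM : p ∈ M := by
      refine closure_minimal ?_ hM.isClosed (h x)
      rintro _ ⟨g, rfl⟩
      exact hM.smul_mem g x hx
    refine Subset.antisymm ?_ (singleton_subset_iff.mpr hpM)
    simpa [horb] using hM.dense_orbit p hpM
  · rintro rfl
    refine ⟨singleton_nonempty p, isClosed_singleton, ?_, ?_⟩
    · rintro g x rfl
      exact hp g
    · rintro x rfl
      rw [horb]
      exact subset_closure

theorem exists_fixed_mem_closure_orbit_of_equiv {G : Type u} {X : Type v} {Y : Type w} [Group G]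
    [TopologicalSpace X] [TopologicalSpace Y] [MulAction G X] [MulAction G Y] (Φ : X ≃ₜ Y)
    (hΦ : ∀ (g : G) (x : X), Φ (g • x) = g • Φ x) {p : Y} (hp : IsFixedPoint G p)
    (h : ∀ y : Y, p ∈ closure (MulAction.orbit G y)) :
    IsFixedPoint G (Φ.symm p) ∧ ∀ x : X, Φ.symm p ∈ closure (MulAction.orbit G x) := by
  refine ⟨fun g => Φ.injective ?_, fun x => ?_⟩
  · rw [hΦ, Φ.apply_symm_apply, hp g]
  · refine map_mem_closure Φ.symm.continuous (h (Φ x)) ?_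
    rintro _ ⟨g, rfl⟩
    refine ⟨g, Φ.injective ?_⟩
    change Φ (g • x) = Φ (Φ.symm (g • Φ x))
    rw [hΦ, Φ.apply_symm_apply]

/-! ## The enveloping semigroup of `ℕ ∪ {∞}` -/

local notation "𝓔" => envelopingSemigroup (Equiv.Perm ℕ) (OnePoint ℕ)
local notation "𝓳" => toEnveloping (Equiv.Perm ℕ) (OnePoint ℕ)

theorem isClosed_envelopingSemigroup (G : Type u) (X : Type v) [Group G] [TopologicalSpace X]
    [MulAction G X] [ContinuousConstSMul G X] : IsClosed (envelopingSemigroup G X : Set (X → X)) :=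
  isClosed_closure

instance compactSpace_envelopingSemigroup (G : Type u) (X : Type v) [Group G] [TopologicalSpace X]
    [CompactSpace X] [MulAction G X] [ContinuousConstSMul G X] :
    CompactSpace (envelopingSemigroup G X) :=
  isCompact_iff_compactSpace.mp (isClosed_envelopingSemigroup G X).isCompact

instance continuousSMul_pi {G : Type u} {X : Type v} {ι : Type w} [Group G] [TopologicalSpace G]
    [TopologicalSpace X] [MulAction G X] [ContinuousSMul G X] (S : SubMulAction G (ι → X)) :
    ContinuousSMul G S := by
  refine ⟨Continuous.subtype_mk (f := fun p : G × S => p.1 • (p.2 : ι → X)) ?_ _⟩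
  fun_prop

theorem smul_toEnveloping (G : Type u) (X : Type v) [Group G] [TopologicalSpace X] [MulAction G X]
    [ContinuousConstSMul G X] (g h : G) :
    toEnveloping G X (g * h) = g • toEnveloping G X h :=
  Subtype.ext (funext fun x => mul_smul g h x)

theorem denseRange_toEnveloping (G : Type u) (X : Type v) [Group G] [TopologicalSpace X]
    [MulAction G X] [ContinuousConstSMul G X] : DenseRange (toEnveloping G X) := by
  intro p
  rw [closure_subtype, ← range_comp]
  exact p.2

theorem continuous_toEnveloping (G : Type u) (X : Type v) [Group G] [TopologicalSpace G]
    [TopologicalSpace X] [MulAction G X] [ContinuousSMul G X] :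
    Continuous (toEnveloping G X) := by
  refine Continuous.subtype_mk (f := fun (g : G) (x : X) => g • x) ?_ _
  fun_prop

/-- The coordinates at points of `ℕ` already induce the topology of `G`, because `ℕ` is embedded in
`ℕ ∪ {∞}`. -/
theorem isDenseInducing_toEnveloping : IsDenseInducing 𝓳 := by
  refine ⟨.of_comp (continuous_toEnveloping _ _)
    (g := fun (p : 𝓔) (n : ℕ) => p.1 (n : OnePoint ℕ))
    (continuous_pi fun n => (continuous_apply _).comp continuous_subtype_val) ?_,
    denseRange_toEnveloping _ _⟩
  have h : IsInducing fun g : Equiv.Perm ℕ => (g : ℕ → ℕ) := ⟨rfl⟩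
  exact (IsInducing.piMap fun _ : ℕ => OnePoint.isOpenEmbedding_coe.isInducing).comp h

/-- The finite point `j` is isolated in `ℕ ∪ {∞}`, so hitting it and missing it are both open
conditions. -/
theorem eventually_pattern (p : 𝓔) (i j : ℕ) :
    ∀ᶠ q : 𝓔 in 𝓝 p, q.1 (i : OnePoint ℕ) = (j : OnePoint ℕ) ↔ p.1 (i : OnePoint ℕ) = j := by
  have hc : Continuous fun q : 𝓔 => q.1 (i : OnePoint ℕ) :=
    (continuous_apply _).comp continuous_subtype_val
  by_cases h : p.1 (i : OnePoint ℕ) = j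
  · have ho : IsOpen {(j : OnePoint ℕ)} := by
      simpa using OnePoint.isOpenEmbedding_coe.isOpenMap {j} (isOpen_discrete _)
    filter_upwards [(ho.preimage hc).mem_nhds h] with q hq
    exact iff_of_true hq h
  · filter_upwards [hc.continuousAt.eventually_ne h] with q hq
    exact iff_of_false hq h

/-- Bi-uniformly continuous maps on `S(ℕ)` extend to the enveloping semigroup. -/
theorem IsBiUniform.exists_extension {Z : Type v} [UniformSpace Z] [CompleteSpace Z] [T2Space Z]
    {f : Equiv.Perm ℕ → Z} (hf : IsBiUniform f) :
    ∃ F : 𝓔 → Z, Continuous F ∧ ∀ g, F (𝓳 g) = f g := by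
  have hj := isDenseInducing_toEnveloping
  have hlim : ∀ p : 𝓔, ∃ c, Tendsto f (comap 𝓳 (𝓝 p)) (𝓝 c) := by
    intro p
    have := hj.comap_nhds_neBot p
    refine CompleteSpace.complete (f := map f (comap 𝓳 (𝓝 p))) ⟨inferInstance, ?_⟩
    intro V hV
    -- By completeness it is enough to show that the image filter is Cauchy. Two `W`-steps are
    -- needed, one for each side of the double coset: from `f g` to `f (g * b)` to `f (a * (g *
    -- b))`.
    obtain ⟨W, hW, hWs, hWV⟩ := comp_symm_mem_uniformity_sets hV
    obtain ⟨S, hS⟩ := exists_finset_fixing_subset (hf W hW)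
    have hN : ∀ᶠ q : 𝓔 in 𝓝 p, ∀ i ∈ S, ∀ j ∈ S,
        (q.1 (i : OnePoint ℕ) = (j : OnePoint ℕ) ↔ p.1 (i : OnePoint ℕ) = j) :=
      (Filter.eventually_all_finset S).mpr fun i _ =>
        (Filter.eventually_all_finset S).mpr fun j _ => eventually_pattern p i j
    have hN' := (tendsto_comap (f := 𝓳) (x := 𝓝 p)).eventually hN
    refine mem_prod_iff.mpr ⟨_, image_mem_map hN', _, image_mem_map hN', ?_⟩
    rintro ⟨_, _⟩ ⟨⟨g, hg, rfl⟩, ⟨h, hh, rfl⟩⟩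
    have hgh : ∀ i ∈ S, ∀ j ∈ S, g i = j ↔ h i = j := by
      intro i hi j hj
      have h1 := (hg i hi j hj).trans (hh i hi j hj).symm
      change ((g i : ℕ) : OnePoint ℕ) = j ↔ ((h i : ℕ) : OnePoint ℕ) = j at h1
      rwa [OnePoint.coe_eq_coe, OnePoint.coe_eq_coe] at h1
    obtain ⟨a, b, ha, hb, rfl⟩ := exists_mul_mul_eq_of_pattern hgh
    exact hWV ⟨f (g * b), hWs.symm _ _ (hS b hb g).2, hWs.symm _ _ (hS a ha (g * b)).1⟩
  exact ⟨hj.extend f, hj.continuous_extend hlim, hj.extend_eq' hlim⟩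

/-! ### The constant map at infinity -/

/-- The involution of `ℕ` exchanging `[0, n)` and `[n, 2n)`. -/
def blockSwap (n : ℕ) : Equiv.Perm ℕ :=
  Function.Involutive.toPerm
    (fun x => if x < n then x + n else if x < 2 * n then x - n else x) fun x => by grind

theorem le_blockSwap {n x : ℕ} (h : x < n) : n ≤ blockSwap n x := by
  change n ≤ if x < n then x + n else if x < 2 * n then x - n else x
  rw [if_pos h]
  omega

/-- `blockSwap n` sends each `m < n` to a value at least `n`, so these permutations converge
pointwise to `∞`. -/
theorem const_infty_mem_envelopingSemigroup : (fun _ => OnePoint.infty) ∈ 𝓔 := by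
  refine mem_closure_of_tendsto (f := fun (n : ℕ) (x : OnePoint ℕ) => blockSwap n • x)
    (b := atTop) ?_ (Eventually.of_forall fun n => ⟨_, rfl⟩)
  refine tendsto_pi_nhds.mpr fun x => ?_
  induction x using OnePoint.rec with
  | infty => exact tendsto_const_nhds
  | coe m =>
    have h1 : Tendsto (fun n => blockSwap n m) atTop atTop := by
      refine tendsto_atTop_mono' _ ?_ tendsto_id
      filter_upwards [eventually_gt_atTop m] with n hn using le_blockSwap hn
    have h2 := OnePoint.tendsto_coe_infty (X := ℕ)
    rw [coclosedCompact_eq_cocompact, cocompact_eq_cofinite, Nat.cofinite_eq_atTop] at h2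
    exact h2.comp h1

/-- The constant map at infinity, as an element of the enveloping semigroup. -/
def constInfty : 𝓔 := ⟨_, const_infty_mem_envelopingSemigroup⟩

theorem isFixedPoint_constInfty : IsFixedPoint (Equiv.Perm ℕ) constInfty := fun _ => rfl

/-- Composition on the right with `p` is continuous, carries the translations into the orbit of `p`,
and leaves a constant map unchanged. -/
theorem constInfty_mem_closure_orbit (p : 𝓔) :
    constInfty ∈ closure (MulAction.orbit (Equiv.Perm ℕ) p) := by
  let r : 𝓔 → 𝓔 := fun q => ⟨q.1 ∘ p.1, comp_mem_envelopingSemigroup _ _ q.2 p.2⟩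
  have hr : Continuous r := by
    refine Continuous.subtype_mk (f := fun q : 𝓔 => q.1 ∘ p.1) ?_ _
    exact continuous_pi fun x => (continuous_apply (p.1 x)).comp continuous_subtype_val
  have h : r constInfty ∈ closure (MulAction.orbit (Equiv.Perm ℕ) p) := by
    refine map_mem_closure hr (denseRange_toEnveloping _ _ constInfty) ?_
    rintro _ ⟨g, rfl⟩
    exact ⟨g, rfl⟩
  exact h

theorem uniqueMinimalSetIsFixedPoint_envelopingSemigroup :
    UniqueMinimalSetIsFixedPoint (Equiv.Perm ℕ) 𝓔 :=
  uniqueMinimalSetIsFixedPoint_of_mem_closure_orbit isFixedPoint_constInfty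
    constInfty_mem_closure_orbit

/-! ### Strong uniform continuity of `ℕ ∪ {∞}` and the fixed-point property -/

/-- Each point has an open stabilizer, so `(g * s) • x` and `g • x` are equal, not merely close, for
`s` near `1`. -/
theorem isSUC_onePoint [UniformSpace (OnePoint ℕ)] : IsSUC (Equiv.Perm ℕ) (OnePoint ℕ) := by
  intro x ε hε
  induction x using OnePoint.rec with
  | infty => exact ⟨univ, univ_mem, fun g s _ => refl_mem_uniformity hε⟩
  | coe n =>
    refine ⟨{s | s n = n}, eventually_perm_apply_eq 1 n, fun g s hs => ?_⟩
    have h : (g * s) • (n : OnePoint ℕ) = g • (n : OnePoint ℕ) := by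
      rw [perm_smul_coe, perm_smul_coe, Equiv.Perm.mul_apply, show s n = n from hs]
    rw [h]
    exact refl_mem_uniformity hε

theorem isSUCfpp_perm : IsSUCfpp.{0, w} (Equiv.Perm ℕ) := by
  intro Y _ _ _ _ _ _ hY
  obtain ⟨y⟩ := ‹Nonempty Y›
  obtain ⟨F, hF, hFj⟩ := (hY.isBiUniform_orbit y).exists_extension
  refine ⟨F constInfty, fun g => ?_⟩
  -- Equivariance holds on the dense image of `G`, where `F` is the orbit map, and passes to `𝓔` by
  -- continuity.
  have h : (fun p => g • F p) = fun p => F (g • p) := by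
    refine (denseRange_toEnveloping _ _).equalizer (by fun_prop) (by fun_prop) ?_
    funext k
    change g • F (𝓳 k) = F (g • 𝓳 k)
    rw [← smul_toEnveloping, hFj, hFj, mul_smul]
  exact congrFun h constInfty

/-! ## The algebras `SUC(G)` and `UC(G)` -/

/-- The flow `𝓔` is compact and SUC, and `f` extends continuously to it, so `𝓔` itself serves as the
witness. -/
theorem isSUCFunction_of_mem_uc {f : Equiv.Perm ℕ →ᵇ ℝ} (hf : f ∈ uc (Equiv.Perm ℕ)) :
    IsSUCFunction (Equiv.Perm ℕ) f := by
  obtain ⟨F, hF, hFj⟩ := (isBiUniform_of_mem_uc hf).exists_extension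
  let _ : UniformSpace (OnePoint ℕ) := uniformSpaceOfCompactR1
  exact IsSUCFunction.of_map (Y := 𝓔) ((isSUC_onePoint.pi).subMulAction _) 𝓳
    (continuous_toEnveloping _ _) (smul_toEnveloping _ _) ⟨F, hF⟩ fun g => (hFj g).symm

theorem suc_perm_eq_uc : suc (Equiv.Perm ℕ) (Equiv.Perm ℕ) = uc (Equiv.Perm ℕ) :=
  le_antisymm (fun _ hf => hf.mem_uc) fun _ hf => isSUCFunction_of_mem_uc hf

/-! ### Identification of the Gelfand spaces -/

theorem gIso_gelfandMap_of_eq {G : Type u} [Group G] {X : Type v} [TopologicalSpace X]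
    [MulAction G X] [ContinuousConstSMul G X] {A B : Subalgebra ℝ (X →ᵇ ℝ)} [IsGInvariant G A]
    [IsGInvariant G B] (h : A = B) : GIso G (gelfandMap A) (gelfandMap B) := by
  subst h
  exact ⟨Homeomorph.refl _, fun _ _ => rfl, fun _ => rfl⟩

theorem GIso.symm {G : Type u} {X : Type*} {Y : Type*} {Y' : Type*} [TopologicalSpace Y]
    [TopologicalSpace Y'] [SMul G Y] [SMul G Y'] {ν : X → Y} {ν' : X → Y'} (h : GIso G ν ν') :
    GIso G ν' ν := by
  obtain ⟨Φ, h1, h2⟩ := h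
  refine ⟨Φ.symm, fun g y => Φ.injective ?_, fun x => Φ.injective ?_⟩
  · rw [h1, Φ.apply_symm_apply, Φ.apply_symm_apply]
  · rw [h2, Φ.apply_symm_apply]

theorem GIso.trans {G : Type u} {X : Type*} {Y : Type*} {Y' : Type*} {Y'' : Type*}
    [TopologicalSpace Y] [TopologicalSpace Y'] [TopologicalSpace Y''] [SMul G Y] [SMul G Y']
    [SMul G Y''] {ν : X → Y} {ν' : X → Y'} {ν'' : X → Y''} (h : GIso G ν ν')
    (h' : GIso G ν' ν'') : GIso G ν ν'' := by
  obtain ⟨Φ, h1, h2⟩ := h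
  obtain ⟨Ψ, h3, h4⟩ := h'
  exact ⟨Φ.trans Ψ, fun g y => by simp [h1, h3], fun x => by simp [h2, h4]⟩

/-- If `j : X → E` is a `G`-compactification and `A` is exactly the algebra of the functions on `X`
that extend continuously to `E`, then the Gelfand space of `A` is `E`. -/
theorem gIso_gelfandMap_of_extension {G : Type u} [Group G] {X : Type v} [TopologicalSpace X]
    [MulAction G X] [ContinuousConstSMul G X] {E : Type w} [TopologicalSpace E] [CompactSpace E]
    [T2Space E] [MulAction G E] [ContinuousConstSMul G E] {j : X → E} (hj : Continuous j)
    (hd : DenseRange j) (hjG : ∀ (g : G) (x : X), j (g • x) = g • j x)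
    (A : Subalgebra ℝ (X →ᵇ ℝ)) [IsGInvariant G A]
    (hA : ∀ f : X →ᵇ ℝ, f ∈ A ↔ ∃ F : C(E, ℝ), ∀ x, F (j x) = f x) :
    GIso G (gelfandMap A) j := by
  choose ext hext using fun f : A => (hA f.1).mp f.2
  -- Uniqueness of extensions, from density of `j`, makes `ext` an algebra homomorphism `A → C(E,
  -- ℝ)`.
  have huniq : ∀ {F F' : C(E, ℝ)}, (∀ x, F (j x) = F' (j x)) → F = F' := fun {F F'} h =>
    DFunLike.coe_injective (hd.equalizer F.continuous F'.continuous (funext h))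
  have hadd : ∀ f h, ext (f + h) = ext f + ext h := fun f h => huniq fun x => by
    simp [hext]
  have hmul : ∀ f h, ext (f * h) = ext f * ext h := fun f h => huniq fun x => by
    simp [hext]
  have hsmul : ∀ (c : ℝ) f, ext (c • f) = c • ext f := fun c f => huniq fun x => by
    simp [hext]
  have hone : ext 1 = 1 := huniq fun x => by simp [hext]
  have hbound : ∀ (f : A) (p : E), ‖ext f p‖ ≤ ‖f‖ := by
    intro f p
    refine hd.induction_on (p := fun p => ‖ext f p‖ ≤ ‖f‖) p ?_ fun x => ?_
    · exact isClosed_le (ext f).continuous.norm continuous_const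
    · rw [hext]
      exact BoundedContinuousFunction.norm_coe_le_norm f.1 x
  let ev : E → A →L[ℝ] ℝ := fun p => LinearMap.mkContinuous
    { toFun := fun f => ext f p
      map_add' := fun f h => by simp [hadd]
      map_smul' := fun c f => by simp [hsmul] } 1 fun f => by simpa using hbound f p
  have hev : ∀ p, StrongDual.toWeakDual (ev p) ∈ WeakDual.characterSpace ℝ A := by
    intro p
    rw [WeakDual.CharacterSpace.eq_set_map_one_map_mul]
    refine ⟨?_, fun f h => ?_⟩
    · change ext 1 p = 1
      simp [hone]
    · change ext (f * h) p = ext f p * ext h p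
      simp [hmul]
  let Ψ : E → GelfandSpace A := fun p => ⟨StrongDual.toWeakDual (ev p), hev p⟩
  have hΨ : ∀ p f, Ψ p f = ext f p := fun _ _ => rfl
  have hΨc : Continuous Ψ := by
    refine Continuous.subtype_mk ?_ _
    exact WeakDual.continuous_of_continuous_eval fun f => (ext f).continuous
  -- Restriction along `j` inverts `ext`, so the bijectivity of `Ψ` reduces to Gelfand duality for
  -- `C(E, ℝ)`.
  let T : C(E, ℝ) → A := fun F =>
    ⟨(BoundedContinuousFunction.mkOfCompact F).compContinuous ⟨j, hj⟩, (hA _).mpr ⟨F, fun _ => rfl⟩⟩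
  have hT : ∀ F, ext (T F) = F := fun F => huniq fun x => hext (T F) x
  have hext_surj : ∀ f, T (ext f) = f := fun f => Subtype.ext (by ext x; exact hext f x)
  have hTc : Continuous T := by
    refine Continuous.subtype_mk ?_ _
    exact (BoundedContinuousFunction.continuous_compContinuous _).comp
      (ContinuousMap.isometryEquivBoundedOfCompact E ℝ).continuous
  have hbij : Function.Bijective Ψ := by
    constructor
    · intro p q hpq
      refine (WeakDual.CharacterSpace.continuousMapEval_bijective (X := E) (𝕜 := ℝ)).1 ?_
      refine WeakDual.CharacterSpace.ext fun F => ?_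
      have := DFunLike.congr_fun hpq (T F)
      rw [hΨ, hΨ, hT] at this
      exact this
    · intro φ
      let TL : C(E, ℝ) →L[ℝ] A :=
        { toFun := T, map_add' := fun _ _ => rfl, map_smul' := fun _ _ => rfl, cont := hTc }
      -- The pullback of `φ` along `T` is a character of `C(E, ℝ)`, hence evaluation at some point
      -- of `E`.
      let χ : WeakDual.characterSpace ℝ C(E, ℝ) :=
        ⟨StrongDual.toWeakDual ((WeakDual.CharacterSpace.toCLM φ).comp TL), by
          rw [WeakDual.CharacterSpace.eq_set_map_one_map_mul]
          exact ⟨map_one φ, fun f h => map_mul φ (T f) (T h)⟩⟩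
      obtain ⟨p, hp⟩ := (WeakDual.CharacterSpace.continuousMapEval_bijective (X := E) (𝕜 := ℝ)).2 χ
      refine ⟨p, WeakDual.CharacterSpace.ext fun f => ?_⟩
      have h1 : ext f p = φ (T (ext f)) := DFunLike.congr_fun hp (ext f)
      rw [hΨ, h1, hext_surj]
  refine GIso.symm ⟨hΨc.homeoOfEquivCompactToT2 (f := Equiv.ofBijective Ψ hbij), ?_, ?_⟩
  · intro g p
    change Ψ (g • p) = g • Ψ p
    refine WeakDual.CharacterSpace.ext fun f => ?_
    rw [gelfand_smul_apply, hΨ, hΨ]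
    have h : (ext f).comp ⟨fun q : E => g • q, continuous_const_smul g⟩ =
        ext (translateCLM A g f) := huniq fun x => by
      rw [hext]
      change ext f (g • j x) = f.1 (g • x)
      rw [← hjG, hext]
    exact DFunLike.congr_fun h p
  · intro x
    change Ψ (j x) = gelfandMap A x
    exact WeakDual.CharacterSpace.ext fun f => hext f x

theorem gIso_gelfandMap_uc_toEnveloping :
    GIso (Equiv.Perm ℕ) (gelfandMap (uc (Equiv.Perm ℕ))) 𝓳 := by
  refine gIso_gelfandMap_of_extension (continuous_toEnveloping _ _) (denseRange_toEnveloping _ _)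
    (smul_toEnveloping _ _) _ fun f => ⟨fun hf => ?_, ?_⟩
  · obtain ⟨F, hF, hFj⟩ := (isBiUniform_of_mem_uc hf).exists_extension
    exact ⟨⟨F, hF⟩, hFj⟩
  -- A function that extends to the SUC flow `𝓔` is an SUC function, hence lies in `UC(G)`.
  · rintro ⟨F, hF⟩
    let _ : UniformSpace (OnePoint ℕ) := uniformSpaceOfCompactR1
    exact (IsSUCFunction.of_map (Y := 𝓔) ((isSUC_onePoint.pi).subMulAction _) 𝓳
      (continuous_toEnveloping _ _) (smul_toEnveloping _ _) F fun g => (hF g).symm).mem_uc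

theorem uniqueMinimalSetIsFixedPoint_of_gIso {X : Type u} {Y : Type v} [TopologicalSpace Y]
    [T1Space Y] [MulAction (Equiv.Perm ℕ) Y] {ν : X → Y} {ν' : X → 𝓔}
    (h : GIso (Equiv.Perm ℕ) ν ν') : UniqueMinimalSetIsFixedPoint (Equiv.Perm ℕ) Y := by
  obtain ⟨Φ, hΦ, -⟩ := h
  obtain ⟨h1, h2⟩ := exists_fixed_mem_closure_orbit_of_equiv Φ hΦ isFixedPoint_constInfty
    constInfty_mem_closure_orbit
  exact uniqueMinimalSetIsFixedPoint_of_mem_closure_orbit h1 h2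

/-! ## A flow without fixed points -/

/-- The space of tournaments on `ℕ`: of two distinct vertices exactly one dominates the other. -/
def Tournament : Type :=
  {c : ℕ → ℕ → Bool // ∀ x y, x ≠ y → c x y = !c y x}

namespace Tournament

instance : TopologicalSpace Tournament :=
  inferInstanceAs (TopologicalSpace {c : ℕ → ℕ → Bool // ∀ x y, x ≠ y → c x y = !c y x})

instance : T2Space Tournament :=
  inferInstanceAs (T2Space {c : ℕ → ℕ → Bool // ∀ x y, x ≠ y → c x y = !c y x})

theorem continuous_apply (x y : ℕ) : Continuous fun c : Tournament => c.1 x y :=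
  (_root_.continuous_apply y).comp ((_root_.continuous_apply x).comp continuous_subtype_val)

instance : CompactSpace Tournament := by
  have h : IsClosed {c : ℕ → ℕ → Bool | ∀ x y, x ≠ y → c x y = !c y x} := by
    simp only [ofPred_forall]
    refine isClosed_iInter fun x => isClosed_iInter fun y => isClosed_iInter fun _ => ?_
    exact isClosed_eq ((_root_.continuous_apply y).comp (_root_.continuous_apply x))
      ((continuous_of_discreteTopology (f := Bool.not)).comp
        ((_root_.continuous_apply x).comp (_root_.continuous_apply y)))
  exact isCompact_iff_compactSpace.mp h.isCompact

instance : Nonempty Tournament :=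
  ⟨⟨fun x y => decide (x < y), fun x y h => by grind⟩⟩

/-- Relabelling the vertices of a tournament. -/
instance : MulAction (Equiv.Perm ℕ) Tournament where
  smul g c := ⟨fun x y => c.1 (g⁻¹ x) (g⁻¹ y), fun _ _ h => c.2 _ _ fun h' => h (g⁻¹.injective h')⟩
  one_smul _ := rfl
  mul_smul _ _ _ := rfl

instance : ContinuousSMul (Equiv.Perm ℕ) Tournament where
  continuous_smul := by
    refine Continuous.subtype_mk (f := fun (p : Equiv.Perm ℕ × Tournament) (x y : ℕ) =>
      p.2.1 (p.1⁻¹ x) (p.1⁻¹ y)) ?_ _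
    refine continuous_pi fun x => continuous_pi fun y => continuous_iff_continuousAt.mpr ?_
    rintro ⟨g, c⟩
    -- The indices `g⁻¹ x` and `g⁻¹ y` are locally constant, so each coordinate of the action is
    -- locally a fixed coordinate of the tournament.
    have h : ∀ z : ℕ, ∀ᶠ p : Equiv.Perm ℕ × Tournament in 𝓝 (g, c), p.1⁻¹ z = g⁻¹ z := fun z =>
      eventually_eq_of_continuous_nat
        ((continuous_perm_apply z).comp (continuous_inv.comp continuous_fst)) _
    have h1 : Tendsto (fun p : Equiv.Perm ℕ × Tournament => p.2.1 (g⁻¹ x) (g⁻¹ y)) (𝓝 (g, c))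
        (𝓝 (c.1 (g⁻¹ x) (g⁻¹ y))) :=
      ((continuous_apply _ _).comp continuous_snd).tendsto (g, c)
    refine h1.congr' ?_
    filter_upwards [h x, h y] with p hx hy
    rw [hx, hy]

/-- The transposition of `0` and `1` reverses the edge between them. -/
theorem not_isFixedPoint (c : Tournament) : ¬ IsFixedPoint (Equiv.Perm ℕ) c := by
  intro h
  have h1 : c.1 ((Equiv.swap 0 1)⁻¹ 0) ((Equiv.swap 0 1)⁻¹ 1) = c.1 0 1 :=
    congrArg (fun d : Tournament => d.1 0 1) (h (Equiv.swap 0 1))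
  rw [Equiv.swap_inv, Equiv.swap_apply_left, Equiv.swap_apply_right, c.2 0 1 zero_ne_one] at h1
  simp at h1

end Tournament

theorem not_isExtremelyAmenable_perm : ¬ IsExtremelyAmenable.{0, 0} (Equiv.Perm ℕ) := by
  intro h
  obtain ⟨c, hc⟩ := h Tournament
  exact c.not_isFixedPoint hc

end

end TopDyn

theorem mainTheorem9 :
    -- `S(ℕ)`, with the topology of pointwise convergence, is a Polish group
    (IsTopologicalGroup (Equiv.Perm ℕ) ∧ PolishSpace (Equiv.Perm ℕ)) ∧
    -- it is SUC-fpp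
    TopDyn.IsSUCfpp.{0, w} (Equiv.Perm ℕ) ∧
    -- it is not extremely amenable
    ¬ TopDyn.IsExtremelyAmenable.{0, 0} (Equiv.Perm ℕ) ∧
    -- `SUC(G) = UC(G)`, so that `G^SUC = G^UC`
    TopDyn.suc (Equiv.Perm ℕ) (Equiv.Perm ℕ) = TopDyn.uc (Equiv.Perm ℕ) ∧
    TopDyn.GIso (Equiv.Perm ℕ)
      (TopDyn.gelfandMap (TopDyn.suc (Equiv.Perm ℕ) (Equiv.Perm ℕ)))
      (TopDyn.gelfandMap (TopDyn.uc (Equiv.Perm ℕ))) ∧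
    -- `G^UC ≅ E(G, ℕ ∪ {∞})`
    TopDyn.GIso (Equiv.Perm ℕ)
      (TopDyn.gelfandMap (TopDyn.uc (Equiv.Perm ℕ)))
      (TopDyn.toEnveloping (Equiv.Perm ℕ) (OnePoint ℕ)) ∧
    -- these flows have a unique minimal set, which is a fixed point
    TopDyn.UniqueMinimalSetIsFixedPoint (Equiv.Perm ℕ)
      (TopDyn.GelfandSpace (TopDyn.suc (Equiv.Perm ℕ) (Equiv.Perm ℕ))) ∧
    TopDyn.UniqueMinimalSetIsFixedPoint (Equiv.Perm ℕ)
      (TopDyn.GelfandSpace (TopDyn.uc (Equiv.Perm ℕ))) ∧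
    TopDyn.UniqueMinimalSetIsFixedPoint (Equiv.Perm ℕ)
      (TopDyn.envelopingSemigroup (Equiv.Perm ℕ) (OnePoint ℕ)) := by
  exact ⟨⟨inferInstance, inferInstance⟩, TopDyn.isSUCfpp_perm,
    TopDyn.not_isExtremelyAmenable_perm, TopDyn.suc_perm_eq_uc,
    TopDyn.gIso_gelfandMap_of_eq TopDyn.suc_perm_eq_uc, TopDyn.gIso_gelfandMap_uc_toEnveloping,
    TopDyn.uniqueMinimalSetIsFixedPoint_of_gIso
      ((TopDyn.gIso_gelfandMap_of_eq TopDyn.suc_perm_eq_uc).trans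
        TopDyn.gIso_gelfandMap_uc_toEnveloping),
    TopDyn.uniqueMinimalSetIsFixedPoint_of_gIso TopDyn.gIso_gelfandMap_uc_toEnveloping,
    TopDyn.uniqueMinimalSetIsFixedPoint_envelopingSemigroup⟩
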